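/- **Setting.** A single server serves $k\ge 2$ queues, numbered $1,\dots,k$. An instance $I$ consists of finitely many jobs; job $i$ joins a given queue at its release date $r_i\ge 0$ and has processing time $p_i\ge 0$. Write $p_{\max}=\max_i p_i$ and $p_{\min}=\min_i p_i$, and let $\gamma\ge 1$ be a constant. Service is non-preemptive, one job at a time, and never before the release date. A setup time $\tau\ge 0$ is needed whenever the server switches from one queue to another, and before it serves for the first time. The total completion time is the sum over all jobs of the time at which the job is finished. $C^*(I)$ is its infimum over all feasible (offline) schedules, and $C^e(I)$ is its value for the schedule that a deterministic policy $e$ gives to $I$. **The class $\Pi_1$** (cyclic exhaustive policies which skip empty queues and allow bounded waiting). Under a policy of $\Pi_1$ the server makes successive visits to queues. 1. *Exhaustive.* When the server ends a visit at time $t$, no job of that queue released at or before $t$ is unserved. The order of service within a visit is arbitrary. 2. *Bounded waiting.* The server may spend time in a visit waiting for further arrivals at that queue, but a visit in which $n$ jobs are served lasts at most $n\,p_{\max}$, and the bound holds for the running count as well: for each $c\le n$, the $c$-th job completed in the visit is completed at most $c\,p_{\max}$ after the visit began. (A visit begins when the setup for it, if any, is finished.) 3. *Cyclic routing with skipping.*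 If some queue is nonempty when the server ends a visit to queue $q$, it immediately sets up the first nonempty queue in the order $q+1,\dots,k,1,\dots,q-1$. If all queues are empty, it idles at queue $q$ until the next arrival and then visits the queue of that arrival, with no setup if that queue is $q$ and with a setup otherwise. 4. *Start.* At time $0$ the server either sets up queue $1$, or skips empty queues already: it sets up the first nonempty queue at time $0$, or, if there is none, waits for the first arrival and then sets up its queue. **Theorem.** Let $\kappa=\max\{\tfrac32\gamma,\;k+1\}$. Every policy $e\in\Pi_1$ is $\kappa$-competitive for $1\mid r_i,\tau,p_{\max}\le\gamma p_{\min}\mid\sum C_i$, that is, $$C^e(I)\le\kappa\,C^*(I)\qquad\text{for every instance } I \text{ with } p_{\max}\le\gamma\,p_{\min}.$$ If moreover $\tfrac32\gamma\le k+1$ and $\tau>0$, the bound is approximately tight for every $e\in\Pi_1$: for every $\epsilon>0$ there is an instance $I$ with $0<p_{\min}$ and $p_{\max}\le\gamma\,p_{\min}$ such that $$\frac{C^e(I)}{C^*(I)}>\kappa-\epsilon .$$ -/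

import Mathlib

noncomputable section

namespace Polling

/-- A job instance for a polling system with `k` queues (queue `1` of the system is the
element `0` of `Fin k`): finitely many jobs, job `i` joining queue `queue i` at its release
date `r i` with processing time `p i`. -/
structure JobInstance (k : ℕ) where
  n : ℕ
  queue : Fin n → Fin k
  r : Fin n → ℝ
  p : Fin n → ℝ
  r_nonneg : ∀ i, 0 ≤ r i
  p_nonneg : ∀ i, 0 ≤ p i

namespace JobInstance

variable {k : ℕ}

/-- The largest processing time. -/
def pmax (I : JobInstance k) : ℝ := ⨆ i, I.p i

/-- The smallest processing time. -/
def pmin (I : JobInstance k) : ℝ := ⨅ i, I.p i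

/-- A schedule is given by the starting times of the jobs.  The completion time of job `i`
is `s i + I.p i`; this is the total completion time. -/
def totalCompletion (I : JobInstance k) (s : Fin I.n → ℝ) : ℝ := ∑ i, (s i + I.p i)

/-- The non-preemptive schedules which a single server can carry out: no job starts before its
release date, jobs do not overlap, between two jobs of different queues there is room for a setup,
and a setup is needed before the very first job. -/
structure Feasible (I : JobInstance k) (τ : ℝ) (s : Fin I.n → ℝ) : Prop where
  release : ∀ i, I.r i ≤ s i
  first_setup : ∀ i, τ ≤ s i
  separated : ∀ i j, i ≠ j →
    s i + I.p i + (if I.queue i = I.queue j then 0 else τ) ≤ s j ∨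
    s j + I.p j + (if I.queue i = I.queue j then 0 else τ) ≤ s i

/-- The optimal total completion time of the offline problem. -/
def optimalCompletion (I : JobInstance k) (τ : ℝ) : ℝ :=
  sInf {c | ∃ s, I.Feasible τ s ∧ c = I.totalCompletion s}

end JobInstance

/-- The record of the successive visits `0, 1, …, m - 1` of the server to the queues (values at
indices `≥ m` are irrelevant).  Visit `v` is to `queue v`; it begins at `arrive v`, when the setup
(if there is one) is finished, and it ends at `depart v`.  Job `i` is served in visit `visit i`. -/
structure VisitRecord (k n : ℕ) where
  m : ℕ
  queue : ℕ → Fin k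
  arrive : ℕ → ℝ
  depart : ℕ → ℝ
  visit : Fin n → ℕ

namespace VisitRecord

variable {k : ℕ} {I : JobInstance k}

/-- The jobs served in visit `v`. -/
def batch (V : VisitRecord k I.n) (v : ℕ) : Finset (Fin I.n) :=
  Finset.univ.filter fun i => V.visit i = v

/-- At time `t`, when precisely the visits before visit `v` have been made, queue `j` is not
empty: some job of queue `j` has been released and has not been served. -/
def QueueNonempty (V : VisitRecord k I.n) (v : ℕ) (t : ℝ) (j : Fin k) : Prop :=
  ∃ i, I.queue i = j ∧ I.r i ≤ t ∧ v ≤ V.visit i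

/-- `i` is a next arrival: a job with the earliest release date among the jobs which are
not served before visit `v`. -/
def IsNextArrival (V : VisitRecord k I.n) (v : ℕ) (i : Fin I.n) : Prop :=
  v ≤ V.visit i ∧ ∀ j, v ≤ V.visit j → I.r i ≤ I.r j

/-- `l` is the first queue after `q` in the cyclic order `q + 1, …, k, 1, …, q - 1` for which
`P` holds. -/
def IsCyclicNext (P : Fin k → Prop) (q l : Fin k) : Prop :=
  (q < l ∧ P l ∧ ∀ j, q < j → P j → l ≤ j) ∨
  ((∀ j, q < j → ¬ P j) ∧ l < q ∧ P l ∧ ∀ j, j < q → P j → l ≤ j)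

/-- How the server chooses visit `v + 1` after visit `v`.  If some queue is not empty when the
server ends visit `v`, it sets up the next nonempty queue in cyclic order.
Otherwise it idles at the queue it served last until the next arrival, and goes to the queue of
that arrival, with a setup unless this is the queue where it is idling. -/
def Continues (V : VisitRecord k I.n) (τ : ℝ) (v : ℕ) : Prop :=
  ((∃ j, V.QueueNonempty (v + 1) (V.depart v) j) ∧
    IsCyclicNext (V.QueueNonempty (v + 1) (V.depart v)) (V.queue v) (V.queue (v + 1)) ∧
    V.arrive (v + 1) = V.depart v + τ) ∨
  ((∀ j, ¬ V.QueueNonempty (v + 1) (V.depart v) j) ∧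
    ∃ i, V.IsNextArrival (v + 1) i ∧ V.queue (v + 1) = I.queue i ∧
      V.arrive (v + 1) = I.r i + (if I.queue i = V.queue v then 0 else τ))

/-- How the server begins.  Either it sets up the first queue at time `0`, or it already skips
empty queues: then it sets up the first nonempty queue at time `0`, or, if all queues are
empty, it waits for the first arrival and sets up its queue. -/
def Begins (V : VisitRecord k I.n) (τ : ℝ) : Prop :=
  ((V.queue 0 : ℕ) = 0 ∧ V.arrive 0 = τ) ∨
  (V.QueueNonempty 0 0 (V.queue 0) ∧ (∀ j, V.QueueNonempty 0 0 j → V.queue 0 ≤ j) ∧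
    V.arrive 0 = τ) ∨
  ((∀ j, ¬ V.QueueNonempty 0 0 j) ∧
    ∃ i, V.IsNextArrival 0 i ∧ V.queue 0 = I.queue i ∧ V.arrive 0 = I.r i + τ)

/-- The schedule `s` is produced, through the visits `V`, by a cyclic exhaustive server that skips
empty queues and is allowed bounded waiting. -/
structure IsCyclicExhaustive (τ : ℝ) (s : Fin I.n → ℝ) (V : VisitRecord k I.n) : Prop where
  /-- Every job is served, in a visit to its own queue. -/
  visit_lt : ∀ i, V.visit i < V.m
  queue_visit : ∀ i, V.queue (V.visit i) = I.queue i
  /-- Service takes place after the release date and during the visit, one job at a time. -/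
  release : ∀ i, I.r i ≤ s i
  arrive_le : ∀ i, V.arrive (V.visit i) ≤ s i
  le_depart : ∀ i, s i + I.p i ≤ V.depart (V.visit i)
  separated : ∀ i j, i ≠ j → V.visit i = V.visit j → s i + I.p i ≤ s j ∨ s j + I.p j ≤ s i
  /-- Exhaustive service: the queue is empty when the server leaves it. -/
  exhaustive : ∀ v < V.m, ∀ i, I.queue i = V.queue v → I.r i ≤ V.depart v → V.visit i ≤ v
  /-- Bounded waiting: a visit with `n` jobs lasts for at most `n * pmax`. -/
  arrive_le_depart : ∀ v < V.m, V.arrive v ≤ V.depart v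
  depart_le : ∀ v < V.m, V.depart v ≤ V.arrive v + ((V.batch v).card : ℝ) * I.pmax
  /-- This holds for the running count too: the job completed as the `c`-th
  one of its visit is completed at most `c * pmax` after the beginning of the visit. -/
  completion_le : ∀ i, s i + I.p i ≤ V.arrive (V.visit i) +
    (((V.batch (V.visit i)).filter fun j => s j + I.p j ≤ s i + I.p i).card : ℝ) * I.pmax
  /-- Cyclic routing which skips empty queues. -/
  begins : 0 < V.m → V.Begins τ
  continues : ∀ v, v + 1 < V.m → V.Continues τ v

end VisitRecord

/-- A deterministic policy assigns to every instance a schedule (the starting times). -/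
def Policy (k : ℕ) : Type := (I : JobInstance k) → Fin I.n → ℝ

/-- The total completion time of the instance `I` under the policy `e`. -/
def Policy.completion {k : ℕ} (e : Policy k) (I : JobInstance k) : ℝ := I.totalCompletion (e I)

/-- The class of cyclic exhaustive policies which skip empty queues, for setup time `τ`.  The order
of service within a visit and the use of the allowed waiting are not specified. -/
def Pi1 (k : ℕ) (τ : ℝ) : Set (Policy k) :=
  {e | ∀ I : JobInstance k, ∃ V : VisitRecord k I.n, V.IsCyclicExhaustive τ (e I)}

/-- The policy `e` is `ρ`-competitive for the problem with setup time `τ` and processing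
times varying by at most the factor `γ`. -/
def IsCompetitive {k : ℕ} (e : Policy k) (τ γ ρ : ℝ) : Prop :=
  ∀ I : JobInstance k, I.pmax ≤ γ * I.pmin → e.completion I ≤ ρ * I.optimalCompletion τ

end Polling

end

/-!
Upper bound. Let `n` be the number of jobs and call the rank of a job its position in the order of
service of the policy. While a job waits, the server never idles, and each move decreases the
cyclic distance from the server to the queue of the job. So a job meets at most `k` setups after
its release, counting one which is under way at that moment, and bounded waiting charges the rest
of its delay to the jobs served up to it, at `pmax` each:
`C i ≤ r i + k * τ + rank i * pmax` (`completion_le_release_add`). The current visit is charged in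
full, although part of it may lie before the release; this is why the rank counts all earlier jobs and
not only those after the release. As the ranks sum to `n * (n + 1) / 2`, the total is at most
`∑ r i + k * (n * τ) + γ * pmin * (n * (n + 1) / 2)`. The optimum is at least `∑ r i`, and also at
least `n * τ + pmin * (n * (n + 1) / 2)`, because `c` jobs cannot be finished before time
`τ + c * pmin`. Hence the ratio is at most `1 + max γ k`, and for `2 ≤ k` this is at most
`max (3 / 2 * γ) (k + 1)`.

Tightness. One tiny job waits in each queue at time `0`, and a large batch joins the first queue
just after the server has left it (`lateBatch`). Every policy of the class serves the batch only
after `k + 1` setups, whereas the optimal schedule serves it after one setup; what else the optimum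
pays does not grow with the size of the batch.
-/

namespace Polling

open Finset

/-! ### Lower bounds for the offline optimum -/

namespace JobInstance

variable {k : ℕ} (I : JobInstance k)

theorem pmin_le (i : Fin I.n) : I.pmin ≤ I.p i :=
  ciInf_le (Set.finite_range _).bddBelow i

theorem le_pmax (i : Fin I.n) : I.p i ≤ I.pmax :=
  le_ciSup (Set.finite_range _).bddAbove i

theorem pmin_nonneg : 0 ≤ I.pmin := Real.iInf_nonneg I.p_nonneg

theorem pmax_nonneg : 0 ≤ I.pmax := Real.iSup_nonneg I.p_nonneg

theorem exists_feasible {τ : ℝ} (hτ : 0 ≤ τ) : ∃ s, I.Feasible τ s := by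
  have hR : 0 ≤ ∑ j, I.r j := sum_nonneg fun j _ => I.r_nonneg j
  have hP := I.pmax_nonneg
  refine ⟨fun i => τ + ∑ j, I.r j + (i : ℕ) * (I.pmax + τ), ?_, ?_, ?_⟩
  · intro i
    have h1 : I.r i ≤ ∑ j, I.r j := single_le_sum (fun j _ => I.r_nonneg j) (mem_univ i)
    have h2 : 0 ≤ ((i : ℕ) : ℝ) * (I.pmax + τ) := by positivity
    linarith
  · intro i
    have h2 : 0 ≤ ((i : ℕ) : ℝ) * (I.pmax + τ) := by positivity
    linarith
  · have key : ∀ i j : Fin I.n, i < j →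
        τ + ∑ j, I.r j + (i : ℕ) * (I.pmax + τ) + I.p i + τ ≤
          τ + ∑ j, I.r j + (j : ℕ) * (I.pmax + τ) := by
      intro i j hij
      have h1 : ((i : ℕ) : ℝ) + 1 ≤ (j : ℕ) := by exact_mod_cast hij
      have h2 := mul_le_mul_of_nonneg_right h1 (add_nonneg hP hτ)
      have h3 := I.le_pmax i
      linarith
    intro i j hij
    have hite : (if I.queue i = I.queue j then 0 else τ) ≤ τ := by split_ifs <;> simp [hτ]
    rcases lt_or_gt_of_ne hij with h | h
    · left; have := key i j h; linarith
    · right; have := key j i h; linarith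

variable {I} {τ : ℝ} {s : Fin I.n → ℝ}

/-- A set of jobs cannot be finished before a setup and all its services have been made. -/
theorem Feasible.makespan_le (h : I.Feasible τ s) (hτ : 0 ≤ τ) (S : Finset (Fin I.n)) :
    S.Nonempty → ∀ T, (∀ i ∈ S, s i + I.p i ≤ T) → τ + #S * I.pmin ≤ T := by
  induction S using Finset.induction_on_max_value (fun i => s i + I.p i) with
  | empty => intro h; simp at h
  | insert a S ha hmax ih =>
    intro _ T hT
    refine le_trans ?_ (hT a (mem_insert_self a S))
    rw [card_insert_of_notMem ha]
    push_cast
    have hpa := I.pmin_le a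
    rcases S.eq_empty_or_nonempty with rfl | hS
    · have := h.first_setup a
      simp
      linarith
    · have := ih hS (s a + I.p a - I.pmin) fun j hj => by
        have hite : 0 ≤ (if I.queue j = I.queue a then 0 else τ) := by split_ifs <;> simp [hτ]
        have hne : j ≠ a := fun e => ha (e ▸ hj)
        rcases h.separated j a hne with h1 | h1
        · linarith
        · -- Job `j` finishes no later than `a` but starts after it: both `p j` and `pmin` vanish.
          have := hmax j hj
          have := I.pmin_le j
          linarith
      linarith

theorem Feasible.le_sum_completion (h : I.Feasible τ s) (hτ : 0 ≤ τ) (S : Finset (Fin I.n)) :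
    #S * τ + I.pmin * (#S * (#S + 1) / 2) ≤ ∑ i ∈ S, (s i + I.p i) := by
  induction S using Finset.induction_on_max_value (fun i => s i + I.p i) with
  | empty => simp
  | insert a S ha hmax ih =>
    have := h.makespan_le hτ (insert a S) (insert_nonempty a S) (s a + I.p a) fun i hi => by
      rcases mem_insert.1 hi with rfl | hi
      · exact le_rfl
      · exact hmax i hi
    rw [sum_insert ha]
    rw [card_insert_of_notMem ha] at this ⊢
    push_cast at this ⊢
    linarith

theorem le_optimalCompletion (hτ : 0 ≤ τ) {c : ℝ}
    (hc : ∀ s, I.Feasible τ s → c ≤ I.totalCompletion s) : c ≤ I.optimalCompletion τ := by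
  obtain ⟨s, hs⟩ := I.exists_feasible hτ
  refine le_csInf ⟨_, s, hs, rfl⟩ ?_
  rintro _ ⟨s, hs, rfl⟩
  exact hc s hs

variable (I) in
theorem sum_release_le_optimalCompletion (hτ : 0 ≤ τ) : ∑ i, I.r i ≤ I.optimalCompletion τ :=
  le_optimalCompletion hτ fun _ hs => sum_le_sum fun i _ =>
    (hs.release i).trans (le_add_of_nonneg_right (I.p_nonneg i))

variable (I) in
theorem setup_add_work_le_optimalCompletion (hτ : 0 ≤ τ) :
    I.n * τ + I.pmin * (I.n * (I.n + 1) / 2) ≤ I.optimalCompletion τ :=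
  le_optimalCompletion hτ fun _ hs => by
    simpa [totalCompletion] using hs.le_sum_completion hτ univ

theorem Feasible.optimalCompletion_le (h : I.Feasible τ s) (hτ : 0 ≤ τ) :
    I.optimalCompletion τ ≤ I.totalCompletion s := by
  refine csInf_le ⟨0, ?_⟩ ⟨s, h, rfl⟩
  rintro _ ⟨s', hs', rfl⟩
  exact sum_nonneg fun i _ => add_nonneg (hτ.trans (hs'.first_setup i)) (I.p_nonneg i)

end JobInstance

/-! ### Delay of a job under a cyclic exhaustive policy -/

namespace VisitRecord

variable {k : ℕ} {I : JobInstance k} {τ : ℝ} {s : Fin I.n → ℝ} {V : VisitRecord k I.n}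

theorem mem_batch {v : ℕ} {i : Fin I.n} : i ∈ V.batch v ↔ V.visit i = v := by
  simp [batch]

/-- The number of jumps by one queue, in cyclic order, which lead from queue `q` to queue `t`. -/
def cyclicDist (q t : Fin k) : ℕ := if q ≤ t then (t : ℕ) - q else k + t - q

/-- If queue `t` is itself nonempty, the routing rule cannot jump over it. -/
theorem IsCyclicNext.cyclicDist_lt {P : Fin k → Prop} {q l t : Fin k} (h : IsCyclicNext P q l)
    (ht : P t) (hqt : q ≠ t) : cyclicDist l t < cyclicDist q t := by
  have hq := q.isLt
  have hl := l.isLt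
  have htk := t.isLt
  have hne : (q : ℕ) ≠ t := fun e => hqt (Fin.ext e)
  unfold cyclicDist
  rcases h with ⟨h1, -, h3⟩ | ⟨h1, h2, -, h4⟩
  · have h3t := h3 t
    simp only [Fin.lt_def, Fin.le_def] at *
    by_cases hlt : (q : ℕ) < t
    · have := h3t hlt ht
      split_ifs <;> omega
    · split_ifs <;> omega
  · have h1t := h1 t
    have h4t := h4 t
    simp only [Fin.lt_def, Fin.le_def] at *
    by_cases hlt : (q : ℕ) < t
    · exact absurd ht (h1t hlt)
    · have := h4t (by omega) ht
      split_ifs <;> omega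

open Classical in
/-- The position of job `i` in the order of service: by visits, and within a visit by completion
times. -/
noncomputable def rank (s : Fin I.n → ℝ) (V : VisitRecord k I.n) (i : Fin I.n) : ℕ :=
  #{j | V.visit j < V.visit i ∨ V.visit j = V.visit i ∧ s j + I.p j ≤ s i + I.p i}

theorem Continues.depart_le_arrive {v : ℕ} (h : V.Continues τ v) (hτ : 0 ≤ τ) :
    V.depart v ≤ V.arrive (v + 1) := by
  rcases h with ⟨-, -, h⟩ | ⟨h0, i, hi, -, h⟩
  · linarith
  · have h1 : V.depart v < I.r i := by
      by_contra hc
      exact h0 _ ⟨i, rfl, not_lt.1 hc, hi.1⟩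
    have : 0 ≤ (if I.queue i = V.queue v then 0 else τ) := by split_ifs <;> simp [hτ]
    linarith

/-- A setup starts as soon as some unserved job has been released. -/
theorem Continues.arrive_le {v : ℕ} (h : V.Continues τ v) (hτ : 0 ≤ τ) {i : Fin I.n}
    (hi : v + 1 ≤ V.visit i) (hd : V.depart v ≤ I.r i) : V.arrive (v + 1) ≤ I.r i + τ := by
  rcases h with ⟨-, -, h⟩ | ⟨-, j, hj, -, h⟩
  · linarith
  · have : (if I.queue j = V.queue v then 0 else τ) ≤ τ := by split_ifs <;> simp [hτ]
    have := hj.2 i hi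
    linarith

theorem Begins.arrive_le (h : V.Begins τ) (i : Fin I.n) : V.arrive 0 ≤ I.r i + τ := by
  have := I.r_nonneg i
  rcases h with ⟨-, h⟩ | ⟨-, -, h⟩ | ⟨-, j, hj, -, h⟩
  · linarith
  · linarith
  · have := hj.2 i (Nat.zero_le _)
    linarith

namespace IsCyclicExhaustive

variable (h : V.IsCyclicExhaustive τ s)
include h

theorem arrive_mono (hτ : 0 ≤ τ) {v w : ℕ} (hvw : v ≤ w) (hw : w < V.m) :
    V.arrive v ≤ V.arrive w := by
  induction w, hvw using Nat.le_induction with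
  | base => exact le_rfl
  | succ w hvw ih =>
    exact (ih (by omega)).trans <| (h.arrive_le_depart w (by omega)).trans <|
      (h.continues w hw).depart_le_arrive hτ

theorem depart_mono (hτ : 0 ≤ τ) {v w : ℕ} (hvw : v ≤ w) (hw : w < V.m) :
    V.depart v ≤ V.depart w := by
  induction w, hvw using Nat.le_induction with
  | base => exact le_rfl
  | succ w hvw ih =>
    exact (ih (by omega)).trans <| ((h.continues w hw).depart_le_arrive hτ).trans <|
      h.arrive_le_depart _ hw

theorem release_le_depart (i : Fin I.n) : I.r i ≤ V.depart (V.visit i) := by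
  have := h.release i
  have := h.le_depart i
  have := I.p_nonneg i
  linarith

/-- While job `i` is waiting, the server does not idle, and every move brings it closer to the
queue of `i`. -/
theorem continues_of_waiting {i : Fin I.n} {v : ℕ} (hv : v < V.visit i)
    (hr : I.r i ≤ V.depart v) :
    V.arrive (v + 1) = V.depart v + τ ∧
      cyclicDist (V.queue (v + 1)) (I.queue i) < cyclicDist (V.queue v) (I.queue i) := by
  have hm := h.visit_lt i
  have hne : V.QueueNonempty (v + 1) (V.depart v) (I.queue i) := ⟨i, rfl, hr, hv⟩
  rcases h.continues v (by omega) with ⟨-, hc, ha⟩ | ⟨h0, -⟩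
  · refine ⟨ha, hc.cyclicDist_lt hne fun e => ?_⟩
    have := h.exhaustive v (by omega) i e.symm hr
    omega
  · exact absurd hne (h0 _)

/-- The work term counts the jobs served from visit `v` on; the setups are paid for by the
decrease of the cyclic distance. -/
theorem arrive_visit_le (hτ : 0 ≤ τ) {i : Fin I.n} {v : ℕ} (hr : I.r i ≤ V.depart v) (w : ℕ)
    (hvw : v ≤ w) (hw : w ≤ V.visit i) :
    V.arrive w + cyclicDist (V.queue w) (I.queue i) * τ ≤
      V.arrive v + cyclicDist (V.queue v) (I.queue i) * τ +
        #{j | V.visit j < w} * I.pmax := by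
  have hP := I.pmax_nonneg
  have hm := h.visit_lt i
  induction w, hvw using Nat.le_induction with
  | base =>
    have : 0 ≤ (#{j | V.visit j < v} : ℝ) * I.pmax := by positivity
    linarith
  | succ w hvw ih =>
    have ih := ih (by omega)
    obtain ⟨ha, hd⟩ := h.continues_of_waiting (i := i) (v := w) (by omega)
      (hr.trans (h.depart_mono hτ hvw (by omega)))
    have hdep := h.depart_le w (by omega)
    have hcard : #{j | V.visit j < w + 1} = #{j | V.visit j < w} + #(V.batch w) := by
      rw [batch, ← card_union_of_disjoint]
      · congr 1
        ext j
        simp only [mem_filter, mem_union, mem_univ, true_and]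
        omega
      · rw [disjoint_filter]
        intro j _ h1 h2
        omega
    have hd' : (cyclicDist (V.queue (w + 1)) (I.queue i) : ℝ) + 1 ≤
        cyclicDist (V.queue w) (I.queue i) := by exact_mod_cast hd
    have := mul_le_mul_of_nonneg_right hd' hτ
    rw [hcard]
    push_cast
    linarith

/-- Only `k` setups and the services of jobs of smaller rank can delay job `i` after its release. -/
theorem completion_le_release_add (hτ : 0 ≤ τ) (i : Fin I.n) :
    s i + I.p i ≤ I.r i + k * τ + rank s V i * I.pmax := by
  classical
  -- `v` is the visit which is under way, or is being set up, when job `i` is released.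
  have hex : ∃ v, I.r i ≤ V.depart v := ⟨_, h.release_le_depart i⟩
  obtain ⟨v, hv, hmin⟩ : ∃ v, I.r i ≤ V.depart v ∧ ∀ w < v, V.depart w < I.r i :=
    ⟨Nat.find hex, Nat.find_spec hex, fun w hw => not_le.1 (Nat.find_min hex hw)⟩
  have hvi : v ≤ V.visit i := by
    by_contra hc
    exact absurd (h.release_le_depart i) (not_le.2 (hmin _ (not_le.1 hc)))
  have hm := h.visit_lt i
  have harr : V.arrive v ≤ I.r i + τ := by
    rcases v with _ | v
    · exact (h.begins (by omega)).arrive_le i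
    · exact (h.continues v (by omega)).arrive_le hτ hvi (hmin v (by omega)).le
  have h1 := h.arrive_visit_le hτ hv (V.visit i) hvi le_rfl
  have h2 := h.completion_le i
  have hdist : (cyclicDist (V.queue v) (I.queue i) : ℝ) + 1 ≤ k := by
    have : cyclicDist (V.queue v) (I.queue i) + 1 ≤ k := by
      have h1 := (V.queue v).isLt
      have h2 := (I.queue i).isLt
      unfold cyclicDist
      simp only [Fin.le_def]
      split_ifs <;> omega
    exact_mod_cast this
  have hdist := mul_le_mul_of_nonneg_right hdist hτ
  have hnn : 0 ≤ (cyclicDist (V.queue (V.visit i)) (I.queue i) : ℝ) * τ := by positivity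
  have hrank : rank s V i = #{j | V.visit j < V.visit i} +
      #{j ∈ V.batch (V.visit i) | s j + I.p j ≤ s i + I.p i} := by
    rw [rank, batch, filter_filter, ← card_union_of_disjoint, ← filter_or]
    rw [disjoint_filter]
    intro j _ h1 h2
    omega
  rw [hrank]
  push_cast
  linarith

/-- With positive processing times, of two jobs only one is before the other. -/
theorem sum_rank_le (hp : ∀ i, 0 < I.p i) :
    ∑ i, (rank s V i : ℝ) ≤ I.n * (I.n + 1) / 2 := by
  let R : Fin I.n → Fin I.n → Prop := fun i j =>
    V.visit j < V.visit i ∨ V.visit j = V.visit i ∧ s j + I.p j ≤ s i + I.p i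
  classical
  have hrank : ∀ i, rank s V i = ∑ j, if R i j then 1 else 0 := fun i => by
    rw [← card_filter]
    simp only [rank, R]
  have hanti : ∀ i j, ((if R i j then 1 else 0) + if R j i then 1 else 0) ≤
      1 + if i = j then 1 else 0 := by
    intro i j
    by_cases hij : i = j
    · subst hij
      by_cases h1 : R i i <;> simp [h1]
    · have : ¬ (R i j ∧ R j i) := by
        rintro ⟨h1, h2⟩
        have hv : V.visit i = V.visit j := by
          rcases h1 with h1 | h1 <;> rcases h2 with h2 | h2 <;> omega
        have h1 : s j + I.p j ≤ s i + I.p i := by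
          rcases h1 with h1 | h1
          · omega
          · exact h1.2
        have h2 : s i + I.p i ≤ s j + I.p j := by
          rcases h2 with h2 | h2
          · omega
          · exact h2.2
        have := hp i
        have := hp j
        rcases h.separated i j hij hv with h3 | h3 <;> linarith
      by_cases h1 : R i j <;> by_cases h2 : R j i <;> simp_all
  have h2 : 2 * ∑ i, rank s V i ≤ I.n * (I.n + 1) := by
    calc 2 * ∑ i, rank s V i
        = (∑ i, ∑ j, if R i j then 1 else 0) + ∑ i, ∑ j, if R j i then 1 else 0 := by
          rw [sum_comm (f := fun i j => if R j i then 1 else 0), two_mul]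
          simp only [hrank]
      _ = ∑ i, ∑ j, ((if R i j then 1 else 0) + if R j i then 1 else 0) := by
          simp only [sum_add_distrib]
      _ ≤ ∑ i : Fin I.n, ∑ j : Fin I.n, (1 + if i = j then 1 else 0) :=
          sum_le_sum fun i _ => sum_le_sum fun j _ => hanti i j
      _ = I.n * (I.n + 1) := by
          simp [sum_add_distrib, mul_add]
  have h3 : (2 : ℝ) * ∑ i, (rank s V i : ℝ) ≤ I.n * (I.n + 1) := by exact_mod_cast h2
  linarith

theorem totalCompletion_le (hτ : 0 ≤ τ) {γ : ℝ} (hpp : I.pmax ≤ γ * I.pmin) :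
    I.totalCompletion s ≤
      ∑ i, I.r i + k * (I.n * τ) + I.pmax * (I.n * (I.n + 1) / 2) := by
  have hP := I.pmax_nonneg
  have hwork : ∑ i, (rank s V i : ℝ) * I.pmax ≤ I.pmax * (I.n * (I.n + 1) / 2) := by
    rw [← sum_mul, mul_comm]
    rcases hP.eq_or_lt with hP0 | hP0
    · simp [← hP0]
    · have hmin : 0 < I.pmin := by
        refine I.pmin_nonneg.lt_of_ne fun e => ?_
        rw [← e] at hpp
        linarith
      exact mul_le_mul_of_nonneg_left (h.sum_rank_le fun i => hmin.trans_le (I.pmin_le i)) hP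
  calc I.totalCompletion s
      ≤ ∑ i, (I.r i + k * τ + rank s V i * I.pmax) :=
        sum_le_sum fun i _ => h.completion_le_release_add hτ i
    _ = ∑ i, I.r i + k * (I.n * τ) + ∑ i, (rank s V i : ℝ) * I.pmax := by
        simp only [sum_add_distrib, sum_const, card_univ, Fintype.card_fin, nsmul_eq_mul]
        ring
    _ ≤ _ := by linarith

end IsCyclicExhaustive

end VisitRecord

/-! ### Competitive ratio -/

theorem isCompetitive_of_mem_Pi1 {k : ℕ} (hk : 2 ≤ k) {τ : ℝ} (hτ : 0 ≤ τ) (γ : ℝ)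
    {e : Policy k} (he : e ∈ Pi1 k τ) :
    IsCompetitive e τ γ (max (3 / 2 * γ) ((k : ℝ) + 1)) := by
  intro I hpp
  obtain ⟨V, hV⟩ := he I
  have h1 : e.completion I ≤ _ := hV.totalCompletion_le hτ hpp
  have h2 := I.sum_release_le_optimalCompletion hτ
  have h3 := I.setup_add_work_le_optimalCompletion hτ
  set n : ℝ := (I.n : ℝ)
  have hn : 0 ≤ n := Nat.cast_nonneg _
  have hk' : (2 : ℝ) ≤ k := by exact_mod_cast hk
  have hw : 0 ≤ n * (n + 1) / 2 := by positivity
  have hopt : 0 ≤ I.optimalCompletion τ := le_trans (sum_nonneg fun i _ => I.r_nonneg i) h2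
  -- Since `2 ≤ k`, the term `3 / 2 * γ` is at least `1 + γ` as soon as `γ` exceeds `k`.
  have hκ : 1 + max γ (k : ℝ) ≤ max (3 / 2 * γ) ((k : ℝ) + 1) := by
    rcases le_total γ k with hc | hc
    · rw [max_eq_right hc, add_comm]
      exact le_max_right _ _
    · rw [max_eq_left hc]
      exact le_trans (by linarith) (le_max_left _ _)
  have hmax : 0 ≤ max γ (k : ℝ) := le_trans (by linarith) (le_max_right _ _)
  calc e.completion I ≤ ∑ i, I.r i + k * (n * τ) + I.pmax * (n * (n + 1) / 2) := h1
    _ ≤ ∑ i, I.r i + max γ (k : ℝ) * (n * τ) +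
        max γ (k : ℝ) * I.pmin * (n * (n + 1) / 2) := by
        have hγ := hpp.trans (mul_le_mul_of_nonneg_right (le_max_left γ (k : ℝ)) I.pmin_nonneg)
        gcongr
        exact le_max_right _ _
    _ = ∑ i, I.r i + max γ (k : ℝ) * (n * τ + I.pmin * (n * (n + 1) / 2)) := by ring
    _ ≤ I.optimalCompletion τ + max γ (k : ℝ) * I.optimalCompletion τ := by gcongr
    _ = (1 + max γ (k : ℝ)) * I.optimalCompletion τ := by ring
    _ ≤ _ := mul_le_mul_of_nonneg_right hκ hopt

/-! ### Tightness -/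

/-- The instance which shows tightness: one job per queue at time `0`, and `N` jobs which
join the first queue at time `τ + 2 * δ`, when the server has just left it; all
processing times are `δ`. -/
def lateBatch (k N : ℕ) (τ δ : ℝ) (hk : 0 < k) (hτ : 0 ≤ τ) (hδ : 0 ≤ δ) : JobInstance k where
  n := k + N
  queue i := if h : (i : ℕ) < k then ⟨i, h⟩ else ⟨0, hk⟩
  r i := if (i : ℕ) < k then 0 else τ + 2 * δ
  p _ := δ
  r_nonneg i := by split_ifs <;> positivity
  p_nonneg _ := hδ

section LateBatch

variable {k N : ℕ} {τ δ : ℝ} (hk : 0 < k) (hτ : 0 ≤ τ) (hδ : 0 ≤ δ)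

theorem pmin_lateBatch : (lateBatch k N τ δ hk hτ hδ).pmin = δ := by
  have : Nonempty (Fin (lateBatch k N τ δ hk hτ hδ).n) := ⟨⟨0, Nat.add_pos_left hk N⟩⟩
  exact ciInf_const

theorem pmax_lateBatch : (lateBatch k N τ δ hk hτ hδ).pmax = δ := by
  have : Nonempty (Fin (lateBatch k N τ δ hk hτ hδ).n) := ⟨⟨0, Nat.add_pos_left hk N⟩⟩
  exact ciSup_const

theorem lateBatch_queue_castAdd (q : Fin k) :
    (lateBatch k N τ δ hk hτ hδ).queue (Fin.castAdd N q) = q :=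
  dif_pos q.isLt

theorem lateBatch_r_castAdd (q : Fin k) :
    (lateBatch k N τ δ hk hτ hδ).r (Fin.castAdd N q) = 0 :=
  if_pos q.isLt

theorem lateBatch_queue_natAdd (j : Fin N) :
    (lateBatch k N τ δ hk hτ hδ).queue (Fin.natAdd k j) = ⟨0, hk⟩ :=
  dif_neg (by simp)

theorem lateBatch_r_natAdd (j : Fin N) :
    (lateBatch k N τ δ hk hτ hδ).r (Fin.natAdd k j) = τ + 2 * δ :=
  if_neg (by simp)

/-- Offline, the server serves the whole batch before it leaves the first queue. -/
theorem optimalCompletion_lateBatch_le :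
    (lateBatch k N τ δ hk hτ hδ).optimalCompletion τ ≤
      k * (τ + (N + 2) * δ + k * (τ + δ)) + N * (τ + (N + 2) * δ) := by
  let f : ℕ → ℝ := fun x =>
    if x = 0 then τ else
      if x < k then τ + (N + 1) * δ + x * (τ + δ) else τ + 2 * δ + (x - k) * δ
  have hN : (0 : ℝ) ≤ N := Nat.cast_nonneg N
  have hNδ : 0 ≤ N * δ := by positivity
  have hfirst : ∀ x, τ ≤ f x := by
    intro x
    simp only [f]
    split_ifs with h1 h2
    · exact le_rfl
    · have : 0 ≤ (x : ℝ) * (τ + δ) := by positivity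
      linarith
    · have : (k : ℝ) ≤ x := by exact_mod_cast not_lt.1 h2
      have : 0 ≤ ((x : ℝ) - k) * δ := mul_nonneg (by linarith) hδ
      linarith
  have hfeas : (lateBatch k N τ δ hk hτ hδ).Feasible τ (fun i => f i) := by
    refine ⟨fun i => ?_, fun i => hfirst i, fun i j hij => ?_⟩
    · change (if (i : ℕ) < k then 0 else τ + 2 * δ) ≤ f i
      split_ifs with h
      · exact hτ.trans (hfirst i)
      · have : (k : ℝ) ≤ (i : ℕ) := by exact_mod_cast not_lt.1 h
        have : 0 ≤ (((i : ℕ) : ℝ) - k) * δ := mul_nonneg (by linarith) hδ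
        simp only [f, if_neg h, if_neg (show (i : ℕ) ≠ 0 by omega)]
        linarith
    · have hij' : (i : ℕ) ≠ j := fun e => hij (Fin.ext e)
      have hi : (i : ℕ) < k + N := i.isLt
      have hj : (j : ℕ) < k + N := j.isLt
      generalize hc : (if (lateBatch k N τ δ hk hτ hδ).queue i =
        (lateBatch k N τ δ hk hτ hδ).queue j then 0 else τ) = c
      have hcτ : c ≤ τ := by rw [← hc]; split_ifs <;> simp [hτ]
      have hc0 : ((i : ℕ) = 0 ∨ k ≤ (i : ℕ)) → ((j : ℕ) = 0 ∨ k ≤ (j : ℕ)) → c = 0 := by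
        have hq : ∀ l : Fin (k + N), ((l : ℕ) = 0 ∨ k ≤ (l : ℕ)) →
            (lateBatch k N τ δ hk hτ hδ).queue l = ⟨0, hk⟩ := by
          intro l hl
          rcases hl with hl | hl
          · simp [lateBatch, hl]
          · exact dif_neg (not_lt.2 hl)
        intro h1 h2
        rw [← hc, if_pos ((hq i h1).trans (hq j h2).symm)]
      change f i + δ + c ≤ f j ∨ f j + δ + c ≤ f i
      clear hc hij
      generalize (i : ℕ) = x at *
      generalize (j : ℕ) = y at *
      -- Only the order of the two jobs matters, so `x` may be taken to be the smaller index.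
      wlog hxy : x < y generalizing x y
      · exact (this y hj x hi hij'.symm (fun h1 h2 => hc0 h2 h1) (by omega)).symm
      have hxy1 : (x : ℝ) + 1 ≤ y := by exact_mod_cast hxy
      have hy0 : y ≠ 0 := by omega
      by_cases hyk : y < k
      · have hy1 := mul_le_mul_of_nonneg_right hxy1 (add_nonneg hτ hδ)
        left
        by_cases hx0 : x = 0
        · simp only [f, hx0, if_true, if_neg hy0, if_pos hyk]
          simp only [hx0, Nat.cast_zero] at hy1
          linarith
        · simp only [f, if_neg hx0, if_neg hy0, if_pos hyk, if_pos (hxy.trans hyk)]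
          linarith
      · by_cases hx0 : x = 0
        · left
          have : (k : ℝ) ≤ y := by exact_mod_cast not_lt.1 hyk
          have : 0 ≤ ((y : ℝ) - k) * δ := mul_nonneg (by linarith) hδ
          have := hc0 (Or.inl hx0) (Or.inr (not_lt.1 hyk))
          simp only [f, if_pos hx0, if_neg hy0, if_neg hyk]
          linarith
        · by_cases hxk : x < k
          · right
            have h1 : (y : ℝ) + 1 ≤ k + N := by exact_mod_cast hj
            have h2 := mul_le_mul_of_nonneg_right h1 hδ
            have h3 : (1 : ℝ) ≤ x := by exact_mod_cast Nat.one_le_iff_ne_zero.2 hx0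
            have h4 := mul_le_mul_of_nonneg_right h3 (add_nonneg hτ hδ)
            simp only [f, if_neg hx0, if_neg hy0, if_neg hyk, if_pos hxk]
            linarith
          · left
            have h2 := mul_le_mul_of_nonneg_right hxy1 hδ
            have := hc0 (Or.inr (not_lt.1 hxk)) (Or.inr (not_lt.1 hyk))
            simp only [f, if_neg hx0, if_neg hy0, if_neg hyk, if_neg hxk]
            linarith
  refine (hfeas.optimalCompletion_le hτ).trans ?_
  change ∑ i : Fin (k + N), (f i + δ) ≤ _
  rw [Fin.sum_univ_add]
  refine add_le_add ?_ ?_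
  · refine (sum_le_card_nsmul _ _ (τ + (N + 2) * δ + k * (τ + δ)) fun q _ => ?_).trans ?_
    · have h1 : ((q : ℕ) : ℝ) ≤ k := by exact_mod_cast q.isLt.le
      have h2 := mul_le_mul_of_nonneg_right h1 (add_nonneg hτ hδ)
      have h3 : 0 ≤ (k : ℝ) * (τ + δ) := by positivity
      simp only [f, Fin.val_castAdd, q.isLt, if_true]
      split_ifs <;> linarith
    · rw [card_univ, Fintype.card_fin, nsmul_eq_mul]
  · refine (sum_le_card_nsmul _ _ (τ + (N + 2) * δ) fun j _ => ?_).trans ?_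
    · have h1 : ((j : ℕ) : ℝ) + 1 ≤ N := by exact_mod_cast j.isLt
      have h2 := mul_le_mul_of_nonneg_right h1 hδ
      simp only [f, Fin.val_natAdd, if_neg (show k + (j : ℕ) ≠ 0 by omega),
        if_neg (show ¬ k + (j : ℕ) < k by omega)]
      push_cast
      linarith
    · rw [card_univ, Fintype.card_fin, nsmul_eq_mul]

variable {V : VisitRecord k (lateBatch k N τ δ hk hτ hδ).n}
  {s : Fin (lateBatch k N τ δ hk hτ hδ).n → ℝ}

theorem lateBatch_begins (h : V.Begins τ) : V.queue 0 = ⟨0, hk⟩ ∧ V.arrive 0 = τ := by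
  have hne : V.QueueNonempty 0 0 ⟨0, hk⟩ :=
    ⟨Fin.castAdd N ⟨0, hk⟩, lateBatch_queue_castAdd hk hτ hδ _,
      (lateBatch_r_castAdd hk hτ hδ _).le, Nat.zero_le _⟩
  rcases h with ⟨h1, h2⟩ | ⟨-, h1, h2⟩ | ⟨h1, -⟩
  · exact ⟨Fin.ext h1, h2⟩
  · exact ⟨Fin.ext (Nat.le_zero.1 (h1 _ hne)), h2⟩
  · exact absurd hne (h1 _)

/-- Of the batch jobs served in visit `0`, the first would be the first or second completion, due by
time `τ + 2 * δ`, but this is when it is released. -/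
theorem visit_natAdd_ne_zero (h : V.IsCyclicExhaustive τ s) (hδ0 : 0 < δ) (j : Fin N) :
    V.visit (Fin.natAdd k j) ≠ 0 := by
  intro hj
  obtain ⟨a, ha, hmin⟩ := exists_min_image {j : Fin N | V.visit (Fin.natAdd k j) = 0}
    (fun j => s (Fin.natAdd k j)) ⟨j, by simpa using hj⟩
  simp only [mem_filter, mem_univ, true_and] at ha hmin
  have hm : 0 < V.m := (Nat.zero_le _).trans_lt (h.visit_lt (Fin.natAdd k j))
  obtain ⟨hq0, ha0⟩ := lateBatch_begins hk hτ hδ (h.begins hm)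
  have hcard : #{i ∈ V.batch (V.visit (Fin.natAdd k a)) |
      s i + (lateBatch k N τ δ hk hτ hδ).p i ≤
        s (Fin.natAdd k a) + (lateBatch k N τ δ hk hτ hδ).p (Fin.natAdd k a)} ≤ 2 := by
    refine le_trans (card_le_card (t := {Fin.castAdd N ⟨0, hk⟩, Fin.natAdd k a}) ?_) card_le_two
    intro i hi
    obtain ⟨hib, hle⟩ := mem_filter.1 hi
    have hi := (VisitRecord.mem_batch.1 hib).trans ha
    change s i + δ ≤ s (Fin.natAdd k a) + δ at hle
    rw [mem_insert, mem_singleton]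
    have hqi := h.queue_visit i
    rw [hi, hq0] at hqi
    induction i using Fin.addCases with
    | left q =>
      left
      rw [lateBatch_queue_castAdd] at hqi
      rw [hqi]
    | right b =>
      right
      by_contra hne
      have h1 := hmin b hi
      have h2 := h.separated _ _ hne (hi.trans ha.symm)
      change s (Fin.natAdd k b) + δ ≤ s (Fin.natAdd k a) ∨
        s (Fin.natAdd k a) + δ ≤ s (Fin.natAdd k b) at h2
      rcases h2 with h2 | h2 <;> linarith
  have h1 := h.completion_le (Fin.natAdd k a)
  have h2 := h.release (Fin.natAdd k a)
  rw [lateBatch_r_natAdd] at h2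
  have h3 : (#{i ∈ V.batch (V.visit (Fin.natAdd k a)) |
      s i + (lateBatch k N τ δ hk hτ hδ).p i ≤
        s (Fin.natAdd k a) + (lateBatch k N τ δ hk hτ hδ).p (Fin.natAdd k a)} : ℝ) ≤ 2 := by
    exact_mod_cast hcard
  have h4 := mul_le_mul_of_nonneg_right h3 hδ
  rw [pmax_lateBatch, ha, ha0] at h1
  rw [ha] at h4
  change s (Fin.natAdd k a) + δ ≤ _ at h1
  linarith

/-- The first `k` visits go through the queues in order. -/
theorem lateBatch_visits (h : V.IsCyclicExhaustive τ s) (v : ℕ) (hv : v < k) :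
    v < V.m ∧ (V.queue v : ℕ) = v ∧ (v + 1) * τ ≤ V.arrive v := by
  induction v using Nat.strong_induction_on with
  | _ v ih =>
  rcases v with _ | v
  · have hm : 0 < V.m := (Nat.zero_le _).trans_lt (h.visit_lt (Fin.castAdd N ⟨0, hk⟩))
    obtain ⟨h1, h2⟩ := lateBatch_begins hk hτ hδ (h.begins hm)
    simp [hm, h1, h2]
  · obtain ⟨hm, hq, ha⟩ := ih v (by omega) (by omega)
    have hvis : v + 1 ≤ V.visit (Fin.castAdd N ⟨v + 1, hv⟩) := by
      by_contra hc
      have h1 := (ih (V.visit (Fin.castAdd N ⟨v + 1, hv⟩)) (by omega) (by omega)).2.1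
      have h2 : V.queue (V.visit (Fin.castAdd N ⟨v + 1, hv⟩)) = ⟨v + 1, hv⟩ :=
        (h.queue_visit _).trans (lateBatch_queue_castAdd hk hτ hδ _)
      have h3 := congrArg Fin.val h2
      simp only at h3
      omega
    have hm' : v + 1 < V.m := hvis.trans_lt (h.visit_lt _)
    have hd := h.arrive_le_depart v hm
    have hne : V.QueueNonempty (v + 1) (V.depart v) ⟨v + 1, hv⟩ := by
      refine ⟨Fin.castAdd N ⟨v + 1, hv⟩, lateBatch_queue_castAdd hk hτ hδ _, ?_, hvis⟩
      rw [lateBatch_r_castAdd]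
      have : 0 ≤ ((v : ℝ) + 1) * τ := by positivity
      linarith
    rcases h.continues v hm' with ⟨-, hc, harr⟩ | ⟨h0, -⟩
    · refine ⟨hm', ?_, ?_⟩
      · rcases hc with ⟨h1, -, h3⟩ | ⟨h1, -⟩
        · have h4 := h3 ⟨v + 1, hv⟩ (by simp [Fin.lt_def, hq]) hne
          simp only [Fin.lt_def, Fin.le_def] at h1 h4
          omega
        · exact absurd hne (h1 _ (by simp [Fin.lt_def, hq]))
      · push_cast
        linarith
    · exact absurd hne (h0 _)

/-- The batch has to wait until the server returns to the first queue after `k + 1` setups. -/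
theorem le_completion_lateBatch (h : V.IsCyclicExhaustive τ s) (hk2 : 2 ≤ k) (hδ0 : 0 < δ)
    (hδτ : 2 * δ ≤ τ) :
    N * ((k + 1) * τ) ≤ (lateBatch k N τ δ hk hτ hδ).totalCompletion s := by
  have hlate : ∀ j : Fin N, (k + 1) * τ ≤ s (Fin.natAdd k j) + δ := by
    intro j
    have hvis : k ≤ V.visit (Fin.natAdd k j) := by
      by_contra hc
      have h1 := (lateBatch_visits hk hτ hδ h _ (not_le.1 hc)).2.1
      have h2 : V.queue (V.visit (Fin.natAdd k j)) = ⟨0, hk⟩ :=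
        (h.queue_visit _).trans (lateBatch_queue_natAdd hk hτ hδ j)
      exact visit_natAdd_ne_zero hk hτ hδ h hδ0 j (h1.symm.trans (congrArg Fin.val h2))
    have hm := h.visit_lt (Fin.natAdd k j)
    obtain ⟨v, rfl⟩ : ∃ v, k = v + 1 := ⟨k - 1, by omega⟩
    obtain ⟨hmv, -, ha⟩ := lateBatch_visits hk hτ hδ h v (by omega)
    have hd := h.arrive_le_depart v hmv
    have hne : V.QueueNonempty (v + 1) (V.depart v) ⟨0, hk⟩ := by
      refine ⟨Fin.natAdd (v + 1) j, lateBatch_queue_natAdd hk hτ hδ j, ?_, hvis⟩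
      rw [lateBatch_r_natAdd]
      have h1 : (1 : ℝ) ≤ v := by exact_mod_cast (by omega : 1 ≤ v)
      have h2 := mul_le_mul_of_nonneg_right h1 hτ
      linarith
    have harr : V.arrive (v + 1) = V.depart v + τ := by
      rcases h.continues v (hvis.trans_lt hm) with ⟨-, -, harr⟩ | ⟨h0, -⟩
      · exact harr
      · exact absurd hne (h0 _)
    have h1 := h.arrive_mono hτ hvis hm
    have h2 := h.arrive_le (Fin.natAdd (v + 1) j)
    push_cast
    linarith
  have hpos : ∀ q : Fin k, 0 ≤ s (Fin.castAdd N q) + δ := fun q => by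
    have := h.release (Fin.castAdd N q)
    rw [lateBatch_r_castAdd] at this
    linarith
  change _ ≤ ∑ i : Fin (k + N), (s i + δ)
  rw [Fin.sum_univ_add]
  have h1 := sum_nonneg fun q (_ : q ∈ univ) => hpos q
  have h2 := card_nsmul_le_sum univ _ _ fun j _ => hlate j
  rw [card_univ, Fintype.card_fin, nsmul_eq_mul] at h2
  linarith

end LateBatch

theorem exists_lt_completion_div {k : ℕ} (hk : 2 ≤ k) {τ : ℝ} (hτ : 0 < τ) {e : Policy k}
    (he : e ∈ Pi1 k τ) {ε : ℝ} (hε : 0 < ε) :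
    ∃ I : JobInstance k, 0 < I.pmin ∧ I.pmax = I.pmin ∧
      (k : ℝ) + 1 - ε < e.completion I / I.optimalCompletion τ := by
  -- With the processing times below, the optimal cost exceeds `N * τ` by at most `K * τ`.
  set K : ℝ := 1 + 2 * k + 2 * k ^ 2 with hK
  obtain ⟨N, hN⟩ := exists_nat_gt (max 1 ((k + 1) * K / ε))
  have hN1 : (1 : ℝ) < N := (le_max_left _ _).trans_lt hN
  have hN2 : (k + 1) * K / ε < N := (le_max_right _ _).trans_lt hN
  have hK0 : 0 < K := by positivity
  have hk0 : 0 < k := by omega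
  obtain ⟨δ, hδ⟩ : ∃ δ, δ = τ / (N * (N + 2)) := ⟨_, rfl⟩
  have hδ0 : 0 < δ := by rw [hδ]; positivity
  have hNδ : N * ((N + 2) * δ) = τ := by
    rw [hδ]
    field_simp
  have hNδ' : (N + 2) * δ ≤ τ := by
    have : 0 ≤ (N + 2) * δ := by positivity
    nlinarith
  have hδτ : 2 * δ ≤ τ := le_trans (by nlinarith) hNδ'
  refine ⟨lateBatch k N τ δ hk0 hτ.le hδ0.le, ?_, ?_, ?_⟩
  · rwa [pmin_lateBatch]
  · rw [pmin_lateBatch, pmax_lateBatch]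
  · obtain ⟨V, hV⟩ := he (lateBatch k N τ δ hk0 hτ.le hδ0.le)
    have hlow := le_completion_lateBatch hk0 hτ.le hδ0.le hV hk hδ0 hδτ
    have hup := optimalCompletion_lateBatch_le (N := N) hk0 hτ.le hδ0.le
    have hpos : 0 < (lateBatch k N τ δ hk0 hτ.le hδ0.le).optimalCompletion τ := by
      refine lt_of_lt_of_le ?_ (JobInstance.setup_add_work_le_optimalCompletion _ hτ.le)
      have hn : 0 < ((lateBatch k N τ δ hk0 hτ.le hδ0.le).n : ℝ) := by
        exact_mod_cast Nat.add_pos_left hk0 N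
      have := (lateBatch k N τ δ hk0 hτ.le hδ0.le).pmin_nonneg
      positivity
    change N * ((k + 1) * τ) ≤ e.completion _ at hlow
    generalize (lateBatch k N τ δ hk0 hτ.le hδ0.le).optimalCompletion τ = C at *
    generalize e.completion (lateBatch k N τ δ hk0 hτ.le hδ0.le) = D at *
    have hC : C ≤ (N + K) * τ := by
      refine hup.trans ?_
      have h1 : (k : ℝ) * (τ + (N + 2) * δ + k * (τ + δ)) ≤ k * (τ + τ + k * (τ + τ)) := by
        gcongr
        linarith
      rw [hK]
      linarith
    rw [lt_div_iff₀ hpos]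
    rw [div_lt_iff₀ hε] at hN2
    rcases le_or_gt ((k : ℝ) + 1 - ε) 0 with hc | hc
    · have h1 : ((k : ℝ) + 1 - ε) * C ≤ 0 := mul_nonpos_of_nonpos_of_nonneg hc hpos.le
      have h2 : (0 : ℝ) < N * ((k + 1) * τ) := by positivity
      linarith
    · have h1 := mul_le_mul_of_nonneg_left hC hc.le
      have h2 : ((k : ℝ) + 1 - ε) * (N + K) < N * (k + 1) := by
        have : 0 < ε * K := by positivity
        linarith
      have h3 := mul_lt_mul_of_pos_right h2 hτ
      linarith

end Polling

theorem theorem1 (k : ℕ) (hk : 2 ≤ k) (τ : ℝ) (hτ : 0 ≤ τ) (γ : ℝ) (hγ : 1 ≤ γ)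
    (e : Polling.Policy k) (he : e ∈ Polling.Pi1 k τ) :
    Polling.IsCompetitive e τ γ (max (3 / 2 * γ) ((k : ℝ) + 1)) ∧
    (0 < τ → 3 / 2 * γ ≤ (k : ℝ) + 1 → ∀ ε : ℝ, 0 < ε →
      ∃ I : Polling.JobInstance k, 0 < I.pmin ∧ I.pmax ≤ γ * I.pmin ∧
        max (3 / 2 * γ) ((k : ℝ) + 1) - ε < e.completion I / I.optimalCompletion τ) := by
  refine ⟨Polling.isCompetitive_of_mem_Pi1 hk hτ γ he, fun hτ0 hγk ε hε => ?_⟩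
  obtain ⟨I, h1, h2, h3⟩ := Polling.exists_lt_completion_div hk hτ0 he hε
  refine ⟨I, h1, h2.trans_le (le_mul_of_one_le_left h1.le hγ), ?_⟩
  rwa [max_eq_right hγk]
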